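/- **Setting.** Let $\mathbf M$ be a non-empty space with coordinates $h^1,h^2,\dots$ identifying it with an open subset of $\mathbb R^\infty$ (a coordinate domain of a manifold modelled on $\mathbb R^\infty$). Let $\mathcal F$ be the ring of functions $f=f(h^1,\dots,h^{m(f)})$ on $\mathbf M$ that depend smoothly on finitely many coordinates, $\mathcal T$ the $\mathcal F$-module of vector fields $Z=\sum z^i\,\partial/\partial h^i$ (infinite sums, arbitrary $z^i\in\mathcal F$; equivalently, the derivations of $\mathcal F$), $\Phi$ the $\mathcal F$-module of differential 1-forms $\sum f^i\,dg^i$ (finite sums, $f^i,g^i\in\mathcal F$), and $\mathcal L_Z$ the Lie derivative. A module is called finite-dimensional if it has a finite $\mathcal F$-basis. For a submodule $\Omega\subset\Phi$ let $\mathcal H=\Omega^\perp\subset\mathcal T$ be the module of all $Z$ with $\omega(Z)=0$ for all $\omega\in\Omega$. For a submodule $\Theta\subset\Phi$ let $\mathcal L_{\mathcal H}\Theta$ be the submodule generated by all $\mathcal L_Z\vartheta$ $(Z\in\mathcal H,\ \vartheta\in\Theta)$. A *good filtration* $\Omega_*$ of $\Omega$ is a chain $\Omega_0\subset\Omega_1\subset\cdots\subset\Omega=\bigcup_l\Omega_l$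 of finite-dimensional submodules with finite-dimensional factors $\mathcal M_l=\Omega_l/\Omega_{l-1}$ $(\Omega_{-1}=0)$ such that $\mathcal L_{\mathcal H}\Omega_l\subset\Omega_{l+1}$ for all $l$ and $\Omega_l+\mathcal L_{\mathcal H}\Omega_l=\Omega_{l+1}$ for all large $l$. A *diffiety* is a submodule $\Omega\subset\Phi$ with finite-dimensional $\Phi/\Omega$ that has a good filtration. Each $Z\in\mathcal H$ acts $\mathcal F$-linearly on $\mathcal M=\bigoplus_l\mathcal M_l$ by $Z[\omega]=[\mathcal L_Z\omega]\in\mathcal M_{l+1}$ for $[\omega]\in\mathcal M_l$, and these actions commute. The good filtration is *involutive* if $\Omega_l+\mathcal L_{\mathcal H}\Omega_l=\Omega_{l+1}$ for all $l\ge 0$ and if $\mathcal H$ has a *quasiregular* basis, that is, a basis $Z_1,\dots,Z_n$ such that for all $0\le i<n$ and $l\ge 1$ multiplication by $Z_{i+1}$ is injective from the degree $l$ to the degree $l+1$ component of $\mathcal M/(Z_1\mathcal M+\cdots+Z_i\mathcal M)$. A vector field $X\in\mathcal H$ is called *not too special* if $X:\mathcal M_l\to\mathcal M_{l+1}$ is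 injective for all large $l$ (for an involutive filtration this is equivalent to injectivity for all $l\ge1$). For $X\in\mathcal T$ and a submodule $\Theta\subset\Phi$ put $\mathrm{Ker}_X\Theta=\{\vartheta\in\Theta:\mathcal L_X\vartheta\in\Theta\}$. **Proposition.** Let $\Omega_*$ be an involutive good filtration of a diffiety $\Omega\subset\Phi$ and let $X\in\mathcal H$ be not too special. Then there is a (unique) integer $K\ge1$ such that $$\Omega_0\supsetneq \mathrm{Ker}_X\Omega_0\supsetneq\cdots\supsetneq(\mathrm{Ker}_X)^K\Omega_0=(\mathrm{Ker}_X)^{K+1}\Omega_0 ,$$ and the terms $$\bar\Omega_l=(\mathrm{Ker}_X)^{K-1-l}\,\Omega_0\quad(0\le l\le K-1),\qquad \bar\Omega_{K-1+l}=\Omega_l\quad(l\ge0)$$ form a strongly ascending filtration of $\Omega$: $\bar\Omega_0\subsetneq\bar\Omega_1\subsetneq\cdots$ and $\bigcup_l\bar\Omega_l=\Omega$. This filtration does not depend on the choice of $X$: for every other not too special $Z\in\mathcal H$ the chain $(\mathrm{Ker}_Z)^k\Omega_0$ is strictly descending up to the same $K$ and stationary from there on, and it gives the same terms $\bar\Omega_l$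 for all $l\ge 0$. -/

import Mathlib

open Filter

namespace Diffiety

/-! ### The structural ring of a space modelled on the infinite product of lines -/

/-- The structural ring of a space `M` with coordinates `h = (h 0, h 1, …)`: all functions
`f = g (h 0, …, h (m - 1))` that depend, smoothly, on a finite number of coordinates.  Here `h` is
meant to be an open embedding into `ℕ → ℝ` (with the product topology), so that `g` is smooth on an
open subset of `ℝ ^ m`. -/
def IsSmoothFun {M : Type*} (h : M → ℕ → ℝ) (f : M → ℝ) : Prop :=
  ∃ (m : ℕ) (g : (Fin m → ℝ) → ℝ),
    ContDiffOn ℝ (⊤ : ℕ∞) g (Set.range fun (P : M) (i : Fin m) => h P i) ∧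
      ∀ P, f P = g fun i => h P i

theorem IsSmoothFun.combine {M : Type*} {h : M → ℕ → ℝ} {f₁ f₂ : M → ℝ}
    (h₁ : IsSmoothFun h f₁) (h₂ : IsSmoothFun h f₂) {φ : ℝ × ℝ → ℝ} (hφ : ContDiff ℝ (⊤ : ℕ∞) φ) :
    IsSmoothFun h fun P => φ (f₁ P, f₂ P) := by
  obtain ⟨m₁, g₁, hg₁, e₁⟩ := h₁
  obtain ⟨m₂, g₂, hg₂, e₂⟩ := h₂
  refine ⟨max m₁ m₂, fun x => φ (g₁ fun i => x (Fin.castLE (le_max_left _ _) i),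
    g₂ fun i => x (Fin.castLE (le_max_right _ _) i)), ?_, fun P => by simp [e₁, e₂]⟩
  refine hφ.comp_contDiffOn (ContDiffOn.prodMk ?_ ?_)
  · refine hg₁.comp (contDiff_pi.2 fun i => contDiff_apply ℝ ℝ _).contDiffOn ?_
    rintro _ ⟨P, rfl⟩
    exact ⟨P, rfl⟩
  · refine hg₂.comp (contDiff_pi.2 fun i => contDiff_apply ℝ ℝ _).contDiffOn ?_
    rintro _ ⟨P, rfl⟩
    exact ⟨P, rfl⟩

/-- The structural ring `𝓕(M)`, a subalgebra of all functions `M → ℝ`. -/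
def structuralRing {M : Type*} (h : M → ℕ → ℝ) : Subalgebra ℝ (M → ℝ) where
  carrier := {f | IsSmoothFun h f}
  mul_mem' {_ _} h₁ h₂ := h₁.combine h₂ (φ := fun p => p.1 * p.2) (contDiff_fst.mul contDiff_snd)
  add_mem' {_ _} h₁ h₂ := h₁.combine h₂ (φ := fun p => p.1 + p.2) (contDiff_fst.add contDiff_snd)
  algebraMap_mem' c := ⟨0, fun _ => c, contDiffOn_const, fun _ => rfl⟩

/-! ### Vector fields, differential 1-forms, Lie derivatives -/

section Forms

variable (F : Type*) [CommRing F] [Algebra ℝ F]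

/-- Vector fields, as the derivations `Z : f ↦ Z f` of the structural ring.  In coordinates they are
the infinite sums `∑ z i ∂/∂(h i)` with arbitrary coefficients `z i = Z (h i)` in the ring. -/
abbrev VectorField := Derivation ℝ F F

/-- The differential `d g`, acting on vector fields by `d g (Z) = Z g`. -/
def differential (g : F) : VectorField F →ₗ[F] F where
  toFun Z := Z g
  map_add' _ _ := rfl
  map_smul' _ _ := rfl

/-- The `F`-module `Φ` of differential 1-forms: finite sums `∑ f i • d (g i)`. -/
def oneForms : Submodule F (VectorField F →ₗ[F] F) :=
  Submodule.span F (Set.range (differential F))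

/-- The type of differential 1-forms, an `F`-module. -/
def OneForm : Type _ := ↥(oneForms F)

instance : AddCommGroup (OneForm F) := inferInstanceAs (AddCommGroup ↥(oneForms F))

instance : Module F (OneForm F) := inferInstanceAs (Module F ↥(oneForms F))

variable {F}

/-- The `F`-linear function `Z ↦ φ (Z)` on vector fields given by a differential 1-form `φ`. -/
def OneForm.eval (φ : OneForm F) : VectorField F →ₗ[F] F := Subtype.val φ

theorem OneForm.eval_ext {φ ψ : OneForm F} (e : φ.eval = ψ.eval) : φ = ψ := Subtype.ext e

theorem OneForm.eval_add (φ ψ : OneForm F) : (φ + ψ).eval = φ.eval + ψ.eval := rfl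

theorem OneForm.eval_smul (f : F) (φ : OneForm F) : (f • φ).eval = f • φ.eval := rfl

/-- The Lie derivative `L_Z φ = Z ⌟ dφ + d (φ (Z))`, that is `(L_Z φ) (Y) = Z (φ (Y)) - φ ([Z, Y])`,
on arbitrary `F`-linear functions of vector fields. -/
def lieDual (Z : VectorField F) (φ : VectorField F →ₗ[F] F) :
    VectorField F →ₗ[F] F where
  toFun Y := Z (φ Y) - φ ⁅Z, Y⁆
  map_add' Y₁ Y₂ := by simp only [map_add, lie_add]; ring
  map_smul' f Y := by
    have e : ⁅Z, f • Y⁆ = f • ⁅Z, Y⁆ + Z f • Y := by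
      ext g
      simp only [Derivation.commutator_apply, Derivation.smul_apply, Derivation.add_apply,
        smul_eq_mul, Derivation.leibniz]
      ring
    simp only [e, map_add, map_smul, smul_eq_mul, Derivation.leibniz, RingHom.id_apply]
    ring

theorem lieDual_add (Z : VectorField F) (φ ψ : VectorField F →ₗ[F] F) :
    lieDual Z (φ + ψ) = lieDual Z φ + lieDual Z ψ := by
  ext Y; simp only [lieDual, LinearMap.coe_mk, AddHom.coe_mk, LinearMap.add_apply, map_add]; ring

theorem lieDual_smul (Z : VectorField F) (f : F) (φ : VectorField F →ₗ[F] F) :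
    lieDual Z (f • φ) = f • lieDual Z φ + Z f • φ := by
  ext Y
  simp only [lieDual, LinearMap.coe_mk, AddHom.coe_mk, LinearMap.add_apply, LinearMap.smul_apply,
    smul_eq_mul, Derivation.leibniz]
  ring

theorem lieDual_differential (Z : VectorField F) (g : F) :
    lieDual Z (differential F g) = differential F (Z g) := by
  ext Y; simp [lieDual, differential, Derivation.commutator_apply]

theorem lieDual_mem (Z : VectorField F) {φ : VectorField F →ₗ[F] F}
    (hφ : φ ∈ oneForms F) : lieDual Z φ ∈ oneForms F := by
  induction hφ using Submodule.span_induction with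
  | mem x hx =>
    obtain ⟨g, rfl⟩ := hx
    rw [lieDual_differential]
    exact Submodule.subset_span ⟨_, rfl⟩
  | zero =>
    have : lieDual Z (0 : VectorField F →ₗ[F] F) = 0 := by ext Y; simp [lieDual]
    rw [this]; exact zero_mem _
  | add x y _ _ hx hy => rw [lieDual_add]; exact add_mem hx hy
  | smul f x hx' hx =>
    rw [lieDual_smul]
    exact add_mem (Submodule.smul_mem _ _ hx) (Submodule.smul_mem _ _ hx')

/-- The Lie derivative `L_Z` on differential 1-forms. -/
def lieD (Z : VectorField F) : OneForm F →+ OneForm F where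
  toFun φ := ⟨lieDual Z φ.eval, lieDual_mem Z φ.2⟩
  map_zero' := OneForm.eval_ext <| by
    ext Y
    change Z 0 - 0 = (0 : F)
    simp
  map_add' φ ψ := OneForm.eval_ext (lieDual_add Z φ.eval ψ.eval)

theorem eval_lieD (Z : VectorField F) (φ : OneForm F) (Y : VectorField F) :
    (lieD Z φ).eval Y = Z (φ.eval Y) - φ.eval ⁅Z, Y⁆ := rfl

theorem lieD_smul (Z : VectorField F) (f : F) (φ : OneForm F) :
    lieD Z (f • φ) = f • lieD Z φ + Z f • φ :=
  OneForm.eval_ext (lieDual_smul Z f φ.eval)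

theorem lieD_lieD (Z Y : VectorField F) (φ : OneForm F) :
    lieD Z (lieD Y φ) = lieD Y (lieD Z φ) + lieD ⁅Z, Y⁆ φ := by
  refine OneForm.eval_ext (LinearMap.ext fun W => ?_)
  have e : φ.eval ⁅⁅Z, Y⁆, W⁆ = φ.eval ⁅Z, ⁅Y, W⁆⁆ - φ.eval ⁅Y, ⁅Z, W⁆⁆ := by
    rw [← map_sub, lie_lie]
  rw [OneForm.eval_add, LinearMap.add_apply]
  simp only [eval_lieD, map_sub, Derivation.commutator_apply, e]
  ring

/-- The orthogonal submodule `Ω^⊥` of all vector fields annihilated by `Ω`; for a diffiety `Ω` this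
is `𝓗 = 𝓗(Ω)`. -/
def orth (Ω : Submodule F (OneForm F)) : Submodule F (VectorField F) where
  carrier := {Z | ∀ ω ∈ Ω, ω.eval Z = 0}
  add_mem' {Z Y} hZ hY ω hω := by rw [map_add, hZ ω hω, hY ω hω, add_zero]
  zero_mem' ω _ := map_zero _
  smul_mem' f Z hZ ω hω := by rw [map_smul, hZ ω hω, smul_zero]

/-- The submodule `L_H Θ` generated by all `L_Z ϑ` with `Z` in `H` and `ϑ` in `Θ`. -/
def lieSpan (H : Set (VectorField F)) (Θ : Submodule F (OneForm F)) : Submodule F (OneForm F) :=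
  Submodule.span F {η | ∃ Z ∈ H, ∃ ϑ ∈ Θ, η = lieD Z ϑ}

/-- `Ker_X Θ`: all `ϑ` in `Θ` with `L_X ϑ` in `Θ`. -/
def kerLie (X : VectorField F) (Θ : Submodule F (OneForm F)) : Submodule F (OneForm F) where
  carrier := {ϑ | ϑ ∈ Θ ∧ lieD X ϑ ∈ Θ}
  add_mem' h₁ h₂ := ⟨add_mem h₁.1 h₂.1, by rw [map_add]; exact add_mem h₁.2 h₂.2⟩
  zero_mem' := ⟨zero_mem _, by rw [map_zero]; exact zero_mem _⟩
  smul_mem' f _ h₁ := ⟨Submodule.smul_mem _ _ h₁.1, by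
    rw [lieD_smul]
    exact add_mem (Submodule.smul_mem _ _ h₁.2) (Submodule.smul_mem _ _ h₁.1)⟩

/-! ### Graded modules of a filtration -/

/-- The preceding term `Ω_{l-1}` of a filtration, where `Ω_{-1} = 0`. -/
def prevTerm (Ωs : ℕ → Submodule F (OneForm F)) : ℕ → Submodule F (OneForm F)
  | 0 => ⊥
  | l + 1 => Ωs l

/-- The submodule `Ω_{l-1} + ∑ L_Z Ω_{l-1}` (`Z` in `S`) of `Ω_l`: the preimage in `Ω_l` of the
degree `l` part `∑ Z M_{l-1}` of `𝔞 M`, where `M` is the graded module of the filtration and `𝔞` is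
the ideal generated by `S` in the algebra of polynomials over `𝓗`. -/
def nullPart (Ωs : ℕ → Submodule F (OneForm F)) (S : Set (VectorField F)) (l : ℕ) :
    Submodule F (OneForm F) :=
  prevTerm Ωs l ⊔ lieSpan S (prevTerm Ωs l)

/-- The degree `l` component of `M / 𝔞 M`, where `M` is the graded module of the filtration and `𝔞`
is the ideal generated by `S`.  For `S = ∅` this is `M_l = Ω_l / Ω_{l-1}`. -/
abbrev GrPart (Ωs : ℕ → Submodule F (OneForm F)) (S : Set (VectorField F)) (l : ℕ) :=
  Ωs l ⧸ (nullPart Ωs S l).submoduleOf (Ωs l)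

/-! ### Diffieties and filtrations -/

/-- A finite-dimensional `F`-module: one with a finite basis. -/
def FiniteDim (F N : Type*) [CommRing F] [AddCommGroup N] [Module F N] : Prop :=
  Module.Free F N ∧ Module.Finite F N

/-- Good filtrations of `Ω` (with bases in the terms and in the factors `Ω_l / Ω_{l-1}`). -/
structure IsGoodFiltration (Ω : Submodule F (OneForm F)) (Ωs : ℕ → Submodule F (OneForm F)) :
    Prop where
  mono : Monotone Ωs
  exhaust : ∀ ω, ω ∈ Ω ↔ ∃ l, ω ∈ Ωs l
  finiteDim : ∀ l, FiniteDim F (Ωs l)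
  finiteDim_gr : ∀ l, FiniteDim F (GrPart Ωs ∅ l)
  lie_le : ∀ l, lieSpan (orth Ω) (Ωs l) ≤ Ωs (l + 1)
  sup_lie : ∀ᶠ l in atTop, Ωs l ⊔ lieSpan (orth Ω) (Ωs l) = Ωs (l + 1)

/-- Diffieties: submodules of `Φ` of finite codimension with a good filtration. -/
def IsDiffiety (Ω : Submodule F (OneForm F)) : Prop :=
  FiniteDim F (OneForm F ⧸ Ω) ∧ ∃ Ωs, IsGoodFiltration Ω Ωs

variable {Ω : Submodule F (OneForm F)} {Ωs : ℕ → Submodule F (OneForm F)}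

theorem IsGoodFiltration.lieD_mem (hΩs : IsGoodFiltration Ω Ωs) {Z : VectorField F}
    (hZ : Z ∈ orth Ω) {l : ℕ} {ω : OneForm F} (hω : ω ∈ Ωs l) : lieD Z ω ∈ Ωs (l + 1) :=
  hΩs.lie_le l (Submodule.subset_span ⟨Z, hZ, ω, hω, rfl⟩)

theorem IsGoodFiltration.lieD_mem_of_prevTerm (hΩs : IsGoodFiltration Ω Ωs) {Z : VectorField F}
    (hZ : Z ∈ orth Ω) {l : ℕ} {ω : OneForm F} (hω : ω ∈ prevTerm Ωs l) : lieD Z ω ∈ Ωs l := by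
  cases l with
  | zero =>
    have : ω = 0 := hω
    rw [this, map_zero]; exact zero_mem _
  | succ l => exact hΩs.lieD_mem hZ hω

theorem IsGoodFiltration.prevTerm_le (hΩs : IsGoodFiltration Ω Ωs) (l : ℕ) :
    prevTerm Ωs l ≤ Ωs l := by
  cases l with
  | zero => exact bot_le
  | succ l => exact hΩs.mono (Nat.le_succ l)

theorem IsGoodFiltration.lie_mem_orth (hΩs : IsGoodFiltration Ω Ωs) {Z Y : VectorField F}
    (hZ : Z ∈ orth Ω) (hY : Y ∈ orth Ω) : ⁅Z, Y⁆ ∈ orth Ω := by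
  intro ω hω
  obtain ⟨l, hl⟩ := (hΩs.exhaust ω).1 hω
  have h₁ : (lieD Z ω).eval Y = 0 :=
    hY _ ((hΩs.exhaust _).2 ⟨_, hΩs.lieD_mem hZ hl⟩)
  rw [eval_lieD, hY ω hω, map_zero, zero_sub, neg_eq_zero] at h₁
  exact h₁

theorem IsGoodFiltration.lieD_mem_nullPart (hΩs : IsGoodFiltration Ω Ωs) {Z : VectorField F}
    (hZ : Z ∈ orth Ω) {S : Set (VectorField F)} (hS : S ⊆ orth Ω) {l : ℕ} {ω : OneForm F}
    (hω : ω ∈ nullPart Ωs S l) : lieD Z ω ∈ nullPart Ωs S (l + 1) := by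
  have key : ∀ η ∈ prevTerm Ωs l, lieD Z η ∈ nullPart Ωs S (l + 1) := fun η hη =>
    Submodule.mem_sup_left (hΩs.lieD_mem_of_prevTerm hZ hη)
  obtain ⟨α, hα, β, hβ, rfl⟩ := Submodule.mem_sup.1 hω
  rw [map_add]
  refine add_mem (key α hα) ?_
  have hβ' : β ∈ Ωs l ∧ lieD Z β ∈ nullPart Ωs S (l + 1) := by
    clear hω
    induction hβ using Submodule.span_induction with
    | mem x hx =>
      obtain ⟨Y, hY, ϑ, hϑ, rfl⟩ := hx
      refine ⟨hΩs.lieD_mem_of_prevTerm (hS hY) hϑ, ?_⟩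
      rw [lieD_lieD]
      refine add_mem (Submodule.mem_sup_right (Submodule.subset_span ⟨Y, hY, _, ?_, rfl⟩))
        (Submodule.mem_sup_left ?_)
      · exact hΩs.lieD_mem_of_prevTerm hZ hϑ
      · exact hΩs.lieD_mem_of_prevTerm (hΩs.lie_mem_orth hZ (hS hY)) hϑ
    | zero => exact ⟨zero_mem _, by rw [map_zero]; exact zero_mem _⟩
    | add x y _ _ hx hy =>
      exact ⟨add_mem hx.1 hy.1, by rw [map_add]; exact add_mem hx.2 hy.2⟩
    | smul f x _ hx =>
      refine ⟨Submodule.smul_mem _ _ hx.1, ?_⟩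
      rw [lieD_smul]
      exact add_mem (Submodule.smul_mem _ _ hx.2)
        (Submodule.mem_sup_left (Submodule.smul_mem (Ωs l) _ hx.1))
  exact hβ'.2

/-- The map `ω ↦ [L_Z ω]` from `Ω_l` to the degree `l + 1` component of `M / 𝔞 M`. -/
def grMulAux (hΩs : IsGoodFiltration Ω Ωs) (Z : orth Ω) (S : Set (VectorField F)) (l : ℕ) :
    Ωs l →ₗ[F] GrPart Ωs S (l + 1) where
  toFun ω := Submodule.Quotient.mk ⟨lieD Z.1 ω.1, hΩs.lieD_mem Z.2 ω.2⟩
  map_add' ω η := by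
    rw [← Submodule.Quotient.mk_add]
    congr 1
    exact Subtype.ext (map_add (lieD Z.1) ω.1 η.1)
  map_smul' f ω := by
    rw [RingHom.id_apply, ← Submodule.Quotient.mk_smul, Submodule.Quotient.eq]
    refine Submodule.mem_sup_left ?_
    change lieD Z.1 (f • ω.1) - f • lieD Z.1 ω.1 ∈ Ωs l
    rw [lieD_smul, add_sub_cancel_left]
    exact Submodule.smul_mem _ _ ω.2

/-- Multiplication by `Z` in `𝓗` from degree `l` to degree `l + 1` of `M / 𝔞 M`, given by
`Z [ω] = [L_Z ω]`, where `𝔞` is the ideal generated by `S`. -/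
def grMul (hΩs : IsGoodFiltration Ω Ωs) (Z : orth Ω) (S : Set (VectorField F)) (hS : S ⊆ orth Ω)
    (l : ℕ) : GrPart Ωs S l →ₗ[F] GrPart Ωs S (l + 1) :=
  Submodule.liftQ _ (grMulAux hΩs Z S l) fun ω hω => by
    rw [LinearMap.mem_ker]
    refine (Submodule.Quotient.mk_eq_zero _).2 ?_
    exact hΩs.lieD_mem_nullPart Z.2 hS hω

/-- A basis `Z_1, …, Z_n` of `𝓗` is quasiregular if all multiplications
`Z_{i+1} : M(i)_l → M(i)_{l+1}` with `l ≥ 1` are injective, where `M(i)` is `M` modulo the ideal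
generated by `Z_1, …, Z_i`. -/
def IsQuasiregular (hΩs : IsGoodFiltration Ω Ωs) {n : ℕ} (b : Module.Basis (Fin n) F (orth Ω)) :
    Prop :=
  ∀ (i : Fin n) (l : ℕ), 1 ≤ l → Function.Injective
    (grMul hΩs (b i) ((fun j => (b j : VectorField F)) '' Set.Iio i)
      (by rintro _ ⟨j, _, rfl⟩; exact (b j).2) l)

/-- Involutive filtrations. -/
def IsInvolutive (hΩs : IsGoodFiltration Ω Ωs) : Prop :=
  (∃ (n : ℕ) (b : Module.Basis (Fin n) F (orth Ω)), IsQuasiregular hΩs b) ∧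
    ∀ l, Ωs l ⊔ lieSpan (orth Ω) (Ωs l) = Ωs (l + 1)

/-- A vector field `X` in `𝓗` is not too special if `X : M_l → M_{l+1}` is injective for all large
`l`.  (If the filtration is involutive, it is then injective for all `l ≥ 1`.) -/
def NotTooSpecial (hΩs : IsGoodFiltration Ω Ωs) (X : orth Ω) : Prop :=
  ∀ᶠ l in atTop, Function.Injective (grMul hΩs X ∅ (Set.empty_subset _) l)

/-! ### The adapted filtration -/

/-- The chain `Θ ⊋ Ker_X Θ ⊋ ⋯ ⊋ (Ker_X)^K Θ = (Ker_X)^{K+1} Θ`, with `K ≥ 1`, is strict up to the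
exponent `K` and stationary from there on. -/
def TerminatesAt (X : VectorField F) (Θ : Submodule F (OneForm F)) (K : ℕ) : Prop :=
  1 ≤ K ∧ (∀ k < K, (kerLie X)^[k + 1] Θ < (kerLie X)^[k] Θ) ∧
    (kerLie X)^[K + 1] Θ = (kerLie X)^[K] Θ

/-- The filtration `(Ker_X)^{K-1} Ω_0 ⊂ ⋯ ⊂ Ker_X Ω_0 ⊂ Ω_0 ⊂ Ω_1 ⊂ ⋯`, for `K ≥ 1`, numbered from
zero, so that `Ω_0` has the number `K - 1`. -/
def adaptedFiltration (X : VectorField F) (Ωs : ℕ → Submodule F (OneForm F)) (K l : ℕ) :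
    Submodule F (OneForm F) :=
  if l < K then (kerLie X)^[K - 1 - l] (Ωs 0) else Ωs (l + 1 - K)

end Forms

end Diffiety

/-!
The graded module `M = ⨁ M_l` of the filtration carries commuting multiplications by the vector
fields in `𝓗`, because `L_X L_Z - L_Z L_X = L_{[X, Z]}` raises the filtration degree by one only.
The first vector field `Z` of a quasiregular basis is injective on all `M_l` with `l ≥ 1`.  If `X` is
injective on `M_{l+1}` and `X m = 0` for some `m` in `M_l`, then `X (Z m) = 0` gives `Z m = 0` and
`m = 0`; so a not too special `X` is injective on all `M_l` with `l ≥ 1` (`GrInjective.of_succ`,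
`NotTooSpecial.grInjective`).

The same commutation shows that, for such an `X`, the derivative `L_Y` along any `Y` in `𝓗` maps
`(Ker_X)^{k+1} Ω_0` into `(Ker_X)^k Ω_0` (`lieD_mem_iterate_kerLie`).  The iterated kernels are thus
determined by all of `𝓗` and do not depend on `X` (`iterate_kerLie_eq`).

It remains to see that the descending chain becomes stationary, although the structural ring is not
Noetherian and has zero divisors.  This is a rank argument (`exists_iterate_kerLie_eq`): more than
`rank Ω_0` forms `ω, L_X ω, L_X^2 ω, …` in `Ω_0` are linearly dependent, and since the structural
ring is reduced, the relation can be chosen such that its leading coefficient does not annihilate the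
class of the next derivative in the free module `Ω_1 / Ω_0`.

The strict inclusions, and `K ≥ 1`, rest on the fact that `Ω` is not finitely generated, since `Φ` is
not (`not_finite_oneForm`): a form depends on finitely many coordinates, so that almost all partial
derivatives annihilate it.
-/

namespace Diffiety

/-! ### Partial derivatives and the infinite dimension of the module of forms -/

section Coordinates

variable {M : Type*} {h : M → ℕ → ℝ}

theorem continuous_shift (x : ℕ → ℝ) (i : ℕ) :
    Continuous fun t : ℝ => x + t • (Pi.single i 1 : ℕ → ℝ) := by
  fun_prop

theorem isOpen_range_coordinates (hh : IsOpen (Set.range h)) (m : ℕ) :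
    IsOpen (Set.range fun (P : M) (k : Fin m) => h P k) := by
  have e : (Set.range fun (P : M) (k : Fin m) => h P k) =
      (fun (x : ℕ → ℝ) (k : Fin m) => x k) '' Set.range h := by
    rw [← Set.range_comp]; rfl
  rw [e, isOpen_iff_mem_nhds]
  rintro _ ⟨x, hx, rfl⟩
  -- a continuous section of the projection, through the given point `x`
  let s : (Fin m → ℝ) → ℕ → ℝ := fun y j => if hj : j < m then y ⟨j, hj⟩ else x j
  have hs : Continuous s := by
    refine continuous_pi fun j => ?_
    by_cases hj : j < m
    · simpa [s, hj] using continuous_apply _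
    · simpa [s, hj] using continuous_const
  have hsx : s (fun k => x k) = x := by
    funext j; simp [s]
  have hmem : s ⁻¹' Set.range h ∈ nhds fun k : Fin m => x k :=
    (hh.preimage hs).mem_nhds (by rw [Set.mem_preimage, hsx]; exact hx)
  refine mem_of_superset hmem fun y hy => ⟨s y, hy, ?_⟩
  funext k; simp [s]

/-- The derivative of `g (h 0, …, h (m - 1))` along the `i`-th coordinate. -/
theorem hasLineDerivAt_extend (hinj : Function.Injective h) (hh : IsOpen (Set.range h))
    {f : M → ℝ} {m : ℕ} {g : (Fin m → ℝ) → ℝ}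
    (hg : ContDiffOn ℝ (⊤ : ℕ∞) g (Set.range fun (P : M) (k : Fin m) => h P k))
    (hf : ∀ P, f P = g fun k => h P k) (P : M) (i : ℕ) :
    HasLineDerivAt ℝ (Function.extend h f 0)
      (fderiv ℝ g (fun k => h P k) fun k => (Pi.single i 1 : ℕ → ℝ) k) (h P) (Pi.single i 1) := by
  have hd : HasFDerivAt g (fderiv ℝ g fun k => h P k) fun k => h P k :=
    ((hg.differentiableOn (by simp)).differentiableAt
      ((isOpen_range_coordinates hh m).mem_nhds ⟨P, rfl⟩)).hasFDerivAt
  have hl := hd.hasLineDerivAt fun k => (Pi.single i 1 : ℕ → ℝ) k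
  refine HasDerivAt.congr_of_eventuallyEq hl ?_
  have ho : (fun t : ℝ => h P + t • (Pi.single i 1 : ℕ → ℝ)) ⁻¹' Set.range h ∈ nhds (0 : ℝ) :=
    (hh.preimage (continuous_shift _ _)).mem_nhds ⟨P, by simp⟩
  filter_upwards [ho] with t ht
  obtain ⟨Q, hQ⟩ := ht
  simp only at hQ
  rw [← hQ, hinj.extend_apply, hf, hQ]
  rfl

/-- The partial derivative `∂/∂(h i)`.  A function on `M` is read off in coordinates, with the value
`0` outside the open set `h (M)`; only its germs at points of `h (M)` matter. -/
noncomputable def partialDeriv (hinj : Function.Injective h) (hh : IsOpen (Set.range h)) (i : ℕ) :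
    VectorField (structuralRing h) :=
  Derivation.mk'
    { toFun := fun f => ⟨fun P => lineDeriv ℝ (Function.extend h f.1 0) (h P) (Pi.single i 1), by
        obtain ⟨m, g, hg, hf⟩ := f.2
        refine ⟨m, fun x => fderiv ℝ g x fun k => (Pi.single i 1 : ℕ → ℝ) k, ?_, fun P =>
          (hasLineDerivAt_extend hinj hh hg hf P i).lineDeriv⟩
        exact (hg.fderiv_of_isOpen (isOpen_range_coordinates hh m) (by simp)).clm_apply
          contDiffOn_const⟩
      map_add' := fun f₁ f₂ => by
        obtain ⟨m₁, g₁, hg₁, hf₁⟩ := f₁.2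
        obtain ⟨m₂, g₂, hg₂, hf₂⟩ := f₂.2
        refine Subtype.ext (funext fun P => ?_)
        have d₁ := hasLineDerivAt_extend hinj hh hg₁ hf₁ P i
        have d₂ := hasLineDerivAt_extend hinj hh hg₂ hf₂ P i
        have e : Function.extend h (f₁ + f₂).1 0 =
            Function.extend h f₁.1 0 + Function.extend h f₂.1 0 := by
          rw [← Function.extend_add, add_zero]; rfl
        change lineDeriv ℝ (Function.extend h (f₁ + f₂).1 0) (h P) (Pi.single i 1) =
          lineDeriv ℝ (Function.extend h f₁.1 0) (h P) (Pi.single i 1) +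
            lineDeriv ℝ (Function.extend h f₂.1 0) (h P) (Pi.single i 1)
        rw [d₁.lineDeriv, d₂.lineDeriv, e]
        exact HasDerivAt.deriv (HasDerivAt.add d₁ d₂)
      map_smul' := fun c f => by
        obtain ⟨m, g, hg, hf⟩ := f.2
        refine Subtype.ext (funext fun P => ?_)
        have d := hasLineDerivAt_extend hinj hh hg hf P i
        have e : Function.extend h (c • f).1 0 = c • Function.extend h f.1 0 := by
          rw [← Function.extend_smul, smul_zero]; rfl
        change lineDeriv ℝ _ _ _ = c * lineDeriv ℝ _ _ _
        rw [d.lineDeriv, e]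
        exact HasDerivAt.deriv (HasDerivAt.const_smul c d) }
    fun f₁ f₂ => by
      obtain ⟨m₁, g₁, hg₁, hf₁⟩ := f₁.2
      obtain ⟨m₂, g₂, hg₂, hf₂⟩ := f₂.2
      refine Subtype.ext (funext fun P => ?_)
      have d₁ := hasLineDerivAt_extend hinj hh hg₁ hf₁ P i
      have d₂ := hasLineDerivAt_extend hinj hh hg₂ hf₂ P i
      have e : Function.extend h (f₁ * f₂).1 0 =
          Function.extend h f₁.1 0 * Function.extend h f₂.1 0 := by
        rw [← Function.extend_mul, mul_zero]; rfl
      change lineDeriv ℝ _ _ _ = f₁.1 P * lineDeriv ℝ _ _ _ + f₂.1 P * lineDeriv ℝ _ _ _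
      rw [d₁.lineDeriv, d₂.lineDeriv, e]
      have d := HasDerivAt.deriv (HasDerivAt.mul d₁ d₂)
      simp only [zero_smul, add_zero, hinj.extend_apply] at d
      refine Eq.trans d ?_
      ring

theorem partialDeriv_apply_eq_zero (hinj : Function.Injective h) (hh : IsOpen (Set.range h))
    (f : structuralRing h) : ∀ᶠ i in atTop, partialDeriv hinj hh i f = 0 := by
  obtain ⟨m, g, hg, hf⟩ := f.2
  filter_upwards [eventually_ge_atTop m] with i hi
  refine Subtype.ext (funext fun P => ?_)
  refine (hasLineDerivAt_extend hinj hh hg hf P i).lineDeriv.trans ?_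
  have : (fun k : Fin m => (Pi.single i 1 : ℕ → ℝ) k) = 0 := by
    funext k
    exact Pi.single_eq_of_ne (by omega) _
  rw [this, map_zero]; rfl

/-- The coordinate function `h i`. -/
def coordinate (h : M → ℕ → ℝ) (i : ℕ) : structuralRing h :=
  ⟨fun P => h P i, i + 1, fun x => x (Fin.last i), (contDiff_apply ℝ ℝ _).contDiffOn,
    fun _ => rfl⟩

theorem partialDeriv_coordinate (hinj : Function.Injective h) (hh : IsOpen (Set.range h)) (i : ℕ) :
    partialDeriv hinj hh i (coordinate h i) = 1 := by
  refine Subtype.ext (funext fun P => ?_)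
  refine (hasLineDerivAt_extend hinj hh (g := fun x : Fin (i + 1) → ℝ => x (Fin.last i))
    (contDiff_apply ℝ ℝ _).contDiffOn (fun _ => rfl) P i).lineDeriv.trans ?_
  have : fderiv ℝ (fun x : Fin (i + 1) → ℝ => x (Fin.last i)) (fun k => h P k) =
      ContinuousLinearMap.proj (Fin.last i) := (hasFDerivAt_apply _ _).fderiv
  rw [this]
  simp

/-- The module of differential 1-forms is not finitely generated: a 1-form is annihilated by all but
finitely many `∂/∂(h i)`, while `d (h i)` is not annihilated by `∂/∂(h i)`. -/
theorem not_finite_oneForm [Nonempty M] (hinj : Function.Injective h) (hh : IsOpen (Set.range h)) :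
    ¬ Module.Finite (structuralRing h) (OneForm (structuralRing h)) := by
  rintro ⟨s, hs⟩
  have key : ∀ φ : OneForm (structuralRing h),
      ∀ᶠ i in atTop, φ.eval (partialDeriv hinj hh i) = 0 := by
    rintro ⟨φ, hφ⟩
    change ∀ᶠ i in atTop, φ (partialDeriv hinj hh i) = 0
    induction hφ using Submodule.span_induction with
    | mem x hx =>
      obtain ⟨g, rfl⟩ := hx
      exact partialDeriv_apply_eq_zero hinj hh g
    | zero => simp
    | add x y _ _ hx hy =>
      filter_upwards [hx, hy] with i h₁ h₂
      rw [LinearMap.add_apply, h₁, h₂, add_zero]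
    | smul f x _ hx =>
      filter_upwards [hx] with i h₁
      rw [LinearMap.smul_apply, h₁, smul_zero]
  obtain ⟨i, hi⟩ := ((eventually_all_finset s).2 fun φ _ => key φ).exists
  have all : ∀ φ : OneForm (structuralRing h), φ.eval (partialDeriv hinj hh i) = 0 := by
    intro φ
    have hφ : φ ∈ Submodule.span (structuralRing h) (s : Set (OneForm (structuralRing h))) := by
      rw [hs]; trivial
    induction hφ using Submodule.span_induction with
    | mem x hx => exact hi x hx
    | zero => rfl
    | add x y _ _ hx hy => rw [OneForm.eval_add, LinearMap.add_apply, hx, hy, add_zero]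
    | smul f x _ hx => rw [OneForm.eval_smul, LinearMap.smul_apply, hx, smul_zero]
  have h0 : partialDeriv hinj hh i (coordinate h i) = 0 :=
    all ⟨differential _ (coordinate h i), Submodule.subset_span ⟨_, rfl⟩⟩
  rw [partialDeriv_coordinate] at h0
  obtain ⟨P⟩ := ‹Nonempty M›
  exact one_ne_zero (congrFun (congrArg Subtype.val h0) P)

end Coordinates

section Kernels

variable {F : Type*} [CommRing F] [Algebra ℝ F]
  {Ω : Submodule F (OneForm F)} {Ωs : ℕ → Submodule F (OneForm F)}

/-! ### Injectivity of multiplications in the graded module -/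

theorem nullPart_empty (Ωs : ℕ → Submodule F (OneForm F)) (l : ℕ) :
    nullPart Ωs ∅ l = prevTerm Ωs l := by
  simp [nullPart, lieSpan]

theorem mem_nullPart_of_grMul_injective (hΩs : IsGoodFiltration Ω Ωs) {Z : orth Ω}
    {S : Set (VectorField F)} {hS : S ⊆ orth Ω} {l : ℕ}
    (hZ : Function.Injective (grMul hΩs Z S hS l)) {ω : OneForm F} (hω : ω ∈ Ωs l)
    (hZω : lieD Z.1 ω ∈ nullPart Ωs S (l + 1)) : ω ∈ nullPart Ωs S l := by
  have h0 : grMul hΩs Z S hS l (Submodule.Quotient.mk ⟨ω, hω⟩) = 0 :=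
    (Submodule.Quotient.mk_eq_zero _).2 hZω
  exact (Submodule.Quotient.mk_eq_zero ((nullPart Ωs S l).submoduleOf (Ωs l))).1
    (hZ (h0.trans (map_zero _).symm))

/-- Injectivity of `Z : M_{l+1} → M_{l+2}` for the graded module `M` of a filtration, in terms of
representatives. -/
def GrInjective (Z : VectorField F) (Ωs : ℕ → Submodule F (OneForm F)) (l : ℕ) : Prop :=
  ∀ ω ∈ Ωs (l + 1), lieD Z ω ∈ Ωs (l + 1) → ω ∈ Ωs l

theorem grInjective_of_grMul_injective (hΩs : IsGoodFiltration Ω Ωs) {Z : orth Ω}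
    {S : Set (VectorField F)} {hS : S ⊆ orth Ω} {l : ℕ} (hS0 : S = ∅)
    (hZ : Function.Injective (grMul hΩs Z S hS (l + 1))) : GrInjective Z.1 Ωs l := by
  subst hS0
  intro ω hω hZω
  have := mem_nullPart_of_grMul_injective hΩs hZ hω (by rw [nullPart_empty]; exact hZω)
  rwa [nullPart_empty] at this

/-- If `X [ω] = 0` then `X (Z [ω]) = Z (X [ω]) = 0`; hence injectivity of `X` descends by one degree
if `Z` is injective there. -/
theorem GrInjective.of_succ (hΩs : IsGoodFiltration Ω Ωs) {X Z : VectorField F} (hX : X ∈ orth Ω)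
    (hZ : Z ∈ orth Ω) {l : ℕ} (hZl : GrInjective Z Ωs l) (hXl : GrInjective X Ωs (l + 1)) :
    GrInjective X Ωs l := by
  refine fun ω hω hXω => hZl ω hω (hXl _ (hΩs.lieD_mem hZ hω) ?_)
  rw [lieD_lieD]
  exact add_mem (hΩs.lieD_mem hZ hXω) (hΩs.lieD_mem (hΩs.lie_mem_orth hX hZ) hω)

theorem NotTooSpecial.grInjective (hΩs : IsGoodFiltration Ω Ωs) {X : orth Ω}
    (hX : NotTooSpecial hΩs X) {Z : VectorField F} (hZ : Z ∈ orth Ω)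
    (hZinj : ∀ l, GrInjective Z Ωs l) (l : ℕ) : GrInjective X.1 Ωs l := by
  obtain ⟨N, hN⟩ := eventually_atTop.1 hX
  have hlarge : GrInjective X.1 Ωs (max l N) :=
    grInjective_of_grMul_injective hΩs rfl (hN _ (by omega))
  exact Nat.decreasingInduction (motive := fun k _ => GrInjective X.1 Ωs k)
    (fun k _ hk => GrInjective.of_succ hΩs X.2 hZ (hZinj k) hk) hlarge (le_max_left l N)

/-! ### Iterated kernels -/

theorem kerLie_le (X : VectorField F) (Θ : Submodule F (OneForm F)) : kerLie X Θ ≤ Θ :=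
  fun _ hω => hω.1

/-- The key point of the argument: the iterated kernels of one injective `X` are carried one step up
by the Lie derivatives with respect to all vector fields in `𝓗`. -/
theorem lieD_mem_iterate_kerLie (hΩs : IsGoodFiltration Ω Ωs) {X : VectorField F}
    (hX : X ∈ orth Ω) (hXinj : GrInjective X Ωs 0) (k : ℕ) {ω : OneForm F}
    (hω : ω ∈ (kerLie X)^[k + 1] (Ωs 0)) {Y : VectorField F} (hY : Y ∈ orth Ω) :
    lieD Y ω ∈ (kerLie X)^[k] (Ωs 0) := by
  induction k generalizing ω Y with
  | zero =>
    refine hXinj _ (hΩs.lieD_mem hY hω.1) ?_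
    rw [lieD_lieD]
    exact add_mem (hΩs.lieD_mem hY hω.2) (hΩs.lieD_mem (hΩs.lie_mem_orth hX hY) hω.1)
  | succ k ih =>
    rw [Function.iterate_succ_apply'] at hω ⊢
    refine ⟨ih hω.1 hY, ?_⟩
    rw [lieD_lieD]
    exact add_mem (ih hω.2 hY) (ih hω.1 (hΩs.lie_mem_orth hX hY))

/-- The iterated kernels do not depend on the injective vector field. -/
theorem iterate_kerLie_eq (hΩs : IsGoodFiltration Ω Ωs) {X Z : VectorField F}
    (hX : X ∈ orth Ω) (hXinj : GrInjective X Ωs 0) (hZ : Z ∈ orth Ω) (hZinj : GrInjective Z Ωs 0)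
    (k : ℕ) : (kerLie Z)^[k] (Ωs 0) = (kerLie X)^[k] (Ωs 0) := by
  induction k with
  | zero => rfl
  | succ k ih =>
    refine le_antisymm (fun ω hω => ?_) (fun ω hω => ?_)
    · have h₁ := lieD_mem_iterate_kerLie hΩs hZ hZinj k hω hX
      rw [Function.iterate_succ_apply'] at hω ⊢
      exact ⟨ih ▸ hω.1, ih ▸ h₁⟩
    · have h₁ := lieD_mem_iterate_kerLie hΩs hX hXinj k hω hZ
      rw [Function.iterate_succ_apply'] at hω ⊢
      exact ⟨ih ▸ hω.1, ih ▸ h₁⟩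

theorem mem_iterate_kerLie {X : VectorField F} {Θ : Submodule F (OneForm F)} {k : ℕ}
    {ω : OneForm F} : ω ∈ (kerLie X)^[k] Θ ↔ ∀ i ≤ k, (lieD X)^[i] ω ∈ Θ := by
  induction k generalizing ω with
  | zero => simp
  | succ k ih =>
    rw [Function.iterate_succ_apply']
    change ω ∈ (kerLie X)^[k] Θ ∧ lieD X ω ∈ (kerLie X)^[k] Θ ↔ _
    rw [ih, ih]
    refine ⟨fun hω i hi => ?_, fun hω => ⟨fun i hi => hω i (by omega), fun i hi => ?_⟩⟩
    · rcases i with _ | i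
      · exact hω.1 0 (by omega)
      · exact hω.2 i (by omega)
    · exact hω (i + 1) (by omega)

/-! ### Stationarity of the iterated kernels -/

/-- More than `m` elements of a free module of rank `m` satisfy a linear relation
with coefficients divisible by a given `c ≠ 0` and not all zero: the images of the elements over the
quotient by the annihilator of `c` are linearly dependent. -/
theorem exists_relation_mul {R N : Type*} [CommRing R] [AddCommGroup N] [Module R N]
    {m : ℕ} (b : Module.Basis (Fin m) R N) (v : Fin (m + 1) → N) {c : R} (hc : c ≠ 0) :
    ∃ a : Fin (m + 1) → R, ∑ i, (c * a i) • v i = 0 ∧ ∃ i, c * a i ≠ 0 := by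
  set A : Ideal R := LinearMap.ker (LinearMap.mulLeft R c) with hA
  have memA : ∀ x, x ∈ A ↔ c * x = 0 := fun x => by simp [hA]
  have : Nontrivial (R ⧸ A) := Ideal.Quotient.nontrivial_iff.2 fun h => by
    have : (1 : R) ∈ A := h ▸ Submodule.mem_top
    rw [memA, mul_one] at this
    exact hc this
  let T : (Fin (m + 1) → R ⧸ A) →ₗ[R ⧸ A] (Fin m → R ⧸ A) :=
    (Matrix.of fun k i => Ideal.Quotient.mk A (b.repr (v i) k)).mulVecLin
  have hT : ¬ Function.Injective T := fun hinj => by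
    have := card_le_of_injective (R ⧸ A) T hinj
    simp at this
  rw [← LinearMap.ker_eq_bot, Submodule.eq_bot_iff] at hT
  push Not at hT
  obtain ⟨y, hy, hy0⟩ := hT
  choose a ha using fun i => Ideal.Quotient.mk_surjective (I := A) (y i)
  refine ⟨a, b.ext_elem fun k => ?_, ?_⟩
  · have hk : Ideal.Quotient.mk A (∑ i, b.repr (v i) k * a i) = 0 := by
      rw [map_sum]
      simp only [map_mul, ha]
      exact congrFun hy k
    rw [Ideal.Quotient.eq_zero_iff_mem, memA, Finset.mul_sum] at hk
    simp only [map_sum, map_smul, Finsupp.coe_finsetSum, Finset.sum_apply, Finsupp.smul_apply,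
      smul_eq_mul, map_zero, Finsupp.zero_apply]
    rw [← hk]
    exact Finset.sum_congr rfl fun i _ => by ring
  · obtain ⟨i, hi⟩ := Function.ne_iff.1 hy0
    refine ⟨i, fun h => hi ?_⟩
    rw [← ha i]
    exact Ideal.Quotient.eq_zero_iff_mem.2 ((memA _).2 h)

/-- The span of `ω, L_X ω, …, L_X^{k-1} ω`. -/
def krylov (X : VectorField F) (ω : OneForm F) (k : ℕ) : Submodule F (OneForm F) :=
  Submodule.span F {η | ∃ i < k, η = (lieD X)^[i] ω}

theorem lieD_mem_krylov (X : VectorField F) (ω : OneForm F) {k : ℕ} {η : OneForm F}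
    (hη : η ∈ krylov X ω k) : lieD X η ∈ krylov X ω (k + 1) := by
  have hle : krylov X ω k ≤ krylov X ω (k + 1) :=
    Submodule.span_mono fun _ ⟨i, hi, e⟩ => ⟨i, by omega, e⟩
  induction hη using Submodule.span_induction with
  | mem x hx =>
    obtain ⟨i, hi, rfl⟩ := hx
    exact Submodule.subset_span ⟨i + 1, by omega, (Function.iterate_succ_apply' _ _ _).symm⟩
  | zero => rw [map_zero]; exact zero_mem _
  | add x y _ _ hx hy => rw [map_add]; exact add_mem hx hy
  | smul f x hx' hx =>
    rw [lieD_smul]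
    exact add_mem (Submodule.smul_mem _ _ hx) (Submodule.smul_mem _ _ (hle hx'))

/-- Differentiating a linear relation keeps its leading coefficient. -/
theorem smul_iterate_mem_krylov (X : VectorField F) (ω : OneForm F) {f : F} {j : ℕ}
    (hj : f • (lieD X)^[j] ω ∈ krylov X ω j) {k : ℕ} (hjk : j ≤ k) :
    f • (lieD X)^[k] ω ∈ krylov X ω k := by
  induction k, hjk using Nat.le_induction with
  | base => exact hj
  | succ k _ ih =>
    have h₁ := lieD_mem_krylov X ω ih
    rw [lieD_smul, ← Function.iterate_succ_apply' (lieD X)] at h₁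
    have h₂ : X f • (lieD X)^[k] ω ∈ krylov X ω (k + 1) :=
      Submodule.smul_mem _ _ (Submodule.subset_span ⟨k, by omega, rfl⟩)
    simpa using sub_mem h₁ h₂

/-- Over a reduced ring, the iterated kernels are stationary from the rank `m` of `Ω_0` on.  If `ω`
is in the `m`-th kernel, then `ω, …, L_X^m ω` lie in `Ω_0` and are related; differentiation turns a
relation with leading coefficient `c * a` into `(c * a) • L_X^{m+1} ω ∈ Ω_0`.  For `c` a non-zero
coordinate of the class of `L_X^{m+1} ω` in the free module `Ω_1 / Ω_0`, this gives `c * a * c = 0`,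
hence `(c * a) ^ 2 = 0` and `c * a = 0`. -/
theorem exists_iterate_kerLie_eq [IsReduced F] (hΩs : IsGoodFiltration Ω Ωs) {X : VectorField F}
    (hX : X ∈ orth Ω) : ∃ k, (kerLie X)^[k + 1] (Ωs 0) = (kerLie X)^[k] (Ωs 0) := by
  have := (hΩs.finiteDim 0).1
  have := (hΩs.finiteDim 0).2
  have := (hΩs.finiteDim_gr 1).1
  rcases subsingleton_or_nontrivial F with hF | hF
  · have := Module.subsingleton F (OneForm F)
    exact ⟨0, Subsingleton.elim _ _⟩
  let b := Module.finBasis F (Ωs 0)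
  set m := Module.finrank F (Ωs 0)
  refine ⟨m, le_antisymm ?_ ?_⟩
  · rw [Function.iterate_succ_apply']
    exact kerLie_le _ _
  intro ω hω
  rw [mem_iterate_kerLie] at hω ⊢
  suffices h : (lieD X)^[m + 1] ω ∈ Ωs 0 by
    intro i hi
    rcases Nat.lt_or_ge m i with h₁ | h₁
    · rwa [show i = m + 1 by omega]
    · exact hω i h₁
  by_contra hmem
  have hmem1 : (lieD X)^[m + 1] ω ∈ Ωs 1 := by
    rw [Function.iterate_succ_apply']
    exact hΩs.lieD_mem hX (hω m le_rfl)
  let q : GrPart Ωs ∅ 1 := Submodule.Quotient.mk ⟨_, hmem1⟩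
  have mk_zero : ∀ {η : OneForm F} (hη : η ∈ Ωs 1),
      (Submodule.Quotient.mk ⟨η, hη⟩ : GrPart Ωs ∅ 1) = 0 ↔ η ∈ Ωs 0 := fun hη => by
    refine (Submodule.Quotient.mk_eq_zero _).trans ?_
    rw [nullPart_empty]
    exact Iff.rfl
  let B := Module.Free.chooseBasis F (GrPart Ωs ∅ 1)
  obtain ⟨s, hs⟩ : ∃ s, B.repr q s ≠ 0 := by
    by_contra! h0
    exact hmem ((mk_zero hmem1).1 (B.ext_elem fun s => by rw [map_zero]; exact h0 s))
  set c := B.repr q s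
  obtain ⟨a, hrel, hne⟩ := exists_relation_mul b
    (fun i => ⟨(lieD X)^[(i : ℕ)] ω, hω i (Nat.lt_succ_iff.1 i.2)⟩) hs
  -- the leading term of the relation
  obtain ⟨j, hj, hmax⟩ : ∃ j, c * a j ≠ 0 ∧ ∀ i, j < i → c * a i = 0 := by
    classical
    obtain ⟨i₀, hi₀⟩ := hne
    have hn : (Finset.univ.filter fun i => c * a i ≠ 0).Nonempty := ⟨i₀, by simpa using hi₀⟩
    refine ⟨_, (Finset.mem_filter.1 (Finset.max'_mem _ hn)).2, fun i hi => ?_⟩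
    by_contra hi0
    exact absurd (Finset.le_max' _ i (by simpa using hi0)) (not_le.2 hi)
  have hlead : (c * a j) • (lieD X)^[(j : ℕ)] ω ∈ krylov X ω j := by
    have hrel' : ∑ i : Fin (m + 1), (c * a i) • (lieD X)^[(i : ℕ)] ω = 0 := by
      simpa using congrArg (Submodule.subtype (Ωs 0)) hrel
    rw [← Finset.add_sum_erase _ _ (Finset.mem_univ j)] at hrel'
    rw [eq_neg_of_add_eq_zero_left hrel']
    refine neg_mem (sum_mem fun i hi => ?_)
    rcases lt_or_gt_of_ne (Finset.ne_of_mem_erase hi) with h₁ | h₁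
    · exact Submodule.smul_mem _ _ (Submodule.subset_span ⟨i, h₁, rfl⟩)
    · rw [hmax i h₁, zero_smul]
      exact zero_mem _
  have hle : krylov X ω (m + 1) ≤ Ωs 0 := by
    refine Submodule.span_le.2 ?_
    rintro _ ⟨i, hi, rfl⟩
    exact hω i (by omega)
  have h0 : (c * a j) • (lieD X)^[m + 1] ω ∈ Ωs 0 :=
    hle (smul_iterate_mem_krylov X ω hlead j.2.le)
  have hq : (c * a j) • q = 0 := (mk_zero (Submodule.smul_mem _ _ hmem1)).2 h0
  have hc : c * a j * c = 0 := by
    simpa [c] using congrArg (fun x => B.repr x s) hq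
  refine hj (eq_zero_of_pow_eq_zero (n := 2) ?_)
  rw [sq, ← mul_assoc, hc, zero_mul]

/-! ### Strictness and the adapted filtration -/

/-- If two consecutive terms coincide, then all later ones do. -/
theorem eq_of_succ_eq (hsup : ∀ l, Ωs l ⊔ lieSpan (orth Ω) (Ωs l) = Ωs (l + 1)) {l : ℕ}
    (hl : Ωs (l + 1) = Ωs l) {k : ℕ} (hk : l ≤ k) : Ωs k = Ωs l := by
  induction k, hk using Nat.le_induction with
  | base => rfl
  | succ k _ ih => rw [← hsup, ih, hsup, hl]

theorem IsInvolutive.strictMono {hΩs : IsGoodFiltration Ω Ωs} (hinv : IsInvolutive hΩs)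
    (hΩ : FiniteDim F (OneForm F ⧸ Ω)) (hΦ : ¬ Module.Finite F (OneForm F)) : StrictMono Ωs := by
  refine strictMono_nat_of_lt_succ fun l => lt_of_le_of_ne (hΩs.mono l.le_succ) fun hl => hΦ ?_
  have e : Ω = Ωs l := by
    ext ω
    refine ⟨fun hω => ?_, fun hω => (hΩs.exhaust ω).2 ⟨l, hω⟩⟩
    obtain ⟨k, hk⟩ := (hΩs.exhaust ω).1 hω
    rw [← eq_of_succ_eq hinv.2 hl.symm (le_max_left l k)]
    exact hΩs.mono (le_max_right l k) hk
  have := hΩ.2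
  have : Module.Finite F Ω := e ▸ (hΩs.finiteDim l).2
  exact Module.Finite.of_submodule_quotient Ω

/-- An involutive filtration whose first two terms differ has a vector field acting injectively in
all degrees `≥ 1`: the first element of a quasiregular basis, which is not empty. -/
theorem IsInvolutive.exists_grInjective {hΩs : IsGoodFiltration Ω Ωs} (hinv : IsInvolutive hΩs)
    (hne : Ωs 0 ≠ Ωs 1) : ∃ Z ∈ orth Ω, ∀ l, GrInjective Z Ωs l := by
  obtain ⟨⟨n, b, hb⟩, hsup⟩ := hinv
  rcases n with _ | n
  · have h0 : ∀ Z ∈ orth Ω, Z = 0 := fun Z hZ => by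
      have : (⟨Z, hZ⟩ : orth Ω) = 0 := b.ext_elem fun i => i.elim0
      exact congrArg Subtype.val this
    refine absurd ?_ hne
    rw [← hsup 0, eq_comm, sup_eq_left]
    refine Submodule.span_le.2 ?_
    rintro _ ⟨Z, hZ, ϑ, -, rfl⟩
    rw [h0 Z hZ]
    have : lieD (0 : VectorField F) ϑ = 0 := OneForm.eval_ext (LinearMap.ext fun Y => by
      rw [eval_lieD, zero_lie, map_zero]
      exact sub_zero _)
    rw [this]
    exact zero_mem _
  · refine ⟨_, (b 0).2, fun l => grInjective_of_grMul_injective hΩs ?_ (hb 0 (l + 1) (by omega))⟩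
    rw [show Set.Iio (0 : Fin (n + 1)) = ∅ from Set.Iio_bot]
    simp

theorem kerLie_ne_self (hsup : Ωs 0 ⊔ lieSpan (orth Ω) (Ωs 0) = Ωs 1) (hΩs : IsGoodFiltration Ω Ωs)
    (hne : Ωs 0 ≠ Ωs 1) {X : VectorField F} (hX : X ∈ orth Ω) (hXinj : GrInjective X Ωs 0) :
    kerLie X (Ωs 0) ≠ Ωs 0 := by
  intro hker
  refine hne ?_
  rw [← hsup, eq_comm, sup_eq_left]
  refine Submodule.span_le.2 ?_
  rintro _ ⟨Y, hY, ϑ, hϑ, rfl⟩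
  exact lieD_mem_iterate_kerLie hΩs hX hXinj 0 (show ϑ ∈ kerLie X (Ωs 0) by rwa [hker]) hY

theorem exists_terminatesAt {X : VectorField F} {Θ : Submodule F (OneForm F)}
    (hne : kerLie X Θ ≠ Θ) (hst : ∃ k, (kerLie X)^[k + 1] Θ = (kerLie X)^[k] Θ) :
    ∃ K, TerminatesAt X Θ K := by
  classical
  refine ⟨Nat.find hst, ?_, fun k hk => lt_of_le_of_ne ?_ (Nat.find_min hst hk), Nat.find_spec hst⟩
  · exact (Nat.find_pos hst).2 hne
  · rw [Function.iterate_succ_apply']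
    exact kerLie_le _ _

theorem TerminatesAt.strictMono_adaptedFiltration {X : VectorField F} {K : ℕ}
    (hK : TerminatesAt X (Ωs 0) K) (hΩs : StrictMono Ωs) :
    StrictMono (adaptedFiltration X Ωs K) := by
  obtain ⟨hK1, hlt, -⟩ := hK
  refine strictMono_nat_of_lt_succ fun l => ?_
  unfold adaptedFiltration
  rcases lt_trichotomy (l + 1) K with h₁ | h₁ | h₁
  · rw [if_pos (by omega), if_pos h₁, show K - 1 - l = K - 1 - (l + 1) + 1 by omega]
    exact hlt _ (by omega)
  · rw [if_pos (by omega), if_neg (by omega), show K - 1 - l = 0 by omega]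
    exact hΩs (by omega)
  · rw [if_neg (by omega), if_neg (by omega)]
    exact hΩs (by omega)

theorem exhaust_adaptedFiltration (hΩs : IsGoodFiltration Ω Ωs) (X : VectorField F) (K : ℕ)
    (ω : OneForm F) : ω ∈ Ω ↔ ∃ l, ω ∈ adaptedFiltration X Ωs K l := by
  refine ⟨fun hω => ?_, fun ⟨l, hl⟩ => ?_⟩
  · obtain ⟨l, hl⟩ := (hΩs.exhaust ω).1 hω
    refine ⟨l + K, ?_⟩
    unfold adaptedFiltration
    rw [if_neg (by omega)]
    exact hΩs.mono (by omega) hl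
  · unfold adaptedFiltration at hl
    split_ifs at hl
    · exact (hΩs.exhaust ω).2 ⟨0, mem_iterate_kerLie.1 hl 0 (Nat.zero_le _)⟩
    · exact (hΩs.exhaust ω).2 ⟨_, hl⟩

end Kernels

end Diffiety

theorem mainTheorem5 {M : Type*} [TopologicalSpace M] [Nonempty M]
    (h : M → ℕ → ℝ) (hh : Topology.IsOpenEmbedding h)
    (Ω : Submodule (Diffiety.structuralRing h) (Diffiety.OneForm (Diffiety.structuralRing h)))
    (hΩ : Diffiety.IsDiffiety Ω)
    (Ωs : ℕ → Submodule (Diffiety.structuralRing h)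
      (Diffiety.OneForm (Diffiety.structuralRing h)))
    (hΩs : Diffiety.IsGoodFiltration Ω Ωs) (hinv : Diffiety.IsInvolutive hΩs)
    (X : Diffiety.orth Ω) (hX : Diffiety.NotTooSpecial hΩs X) :
    ∃ K : ℕ, Diffiety.TerminatesAt X.1 (Ωs 0) K ∧
      StrictMono (Diffiety.adaptedFiltration X.1 Ωs K) ∧
      (∀ ω, ω ∈ Ω ↔ ∃ l, ω ∈ Diffiety.adaptedFiltration X.1 Ωs K l) ∧
      ∀ Z : Diffiety.orth Ω, Diffiety.NotTooSpecial hΩs Z →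
        Diffiety.TerminatesAt Z.1 (Ωs 0) K ∧
          ∀ l, Diffiety.adaptedFiltration Z.1 Ωs K l = Diffiety.adaptedFiltration X.1 Ωs K l := by
  have hinj : Function.Injective h := hh.injective
  have hmono : StrictMono Ωs :=
    hinv.strictMono hΩ.1 (Diffiety.not_finite_oneForm hinj hh.isOpen_range)
  have hne : Ωs 0 ≠ Ωs 1 := (hmono zero_lt_one).ne
  have : IsReduced (Diffiety.structuralRing h) :=
    isReduced_of_injective (Diffiety.structuralRing h).val Subtype.val_injective
  obtain ⟨Z₁, hZ₁, hZ₁inj⟩ := hinv.exists_grInjective hne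
  have hXinj := hX.grInjective hΩs hZ₁ hZ₁inj 0
  obtain ⟨K, hK⟩ := Diffiety.exists_terminatesAt
    (Diffiety.kerLie_ne_self (hinv.2 0) hΩs hne X.2 hXinj)
    (Diffiety.exists_iterate_kerLie_eq hΩs X.2)
  refine ⟨K, hK, hK.strictMono_adaptedFiltration hmono,
    Diffiety.exhaust_adaptedFiltration hΩs X.1 K, fun Z hZ => ?_⟩
  have e := Diffiety.iterate_kerLie_eq hΩs X.2 hXinj Z.2 (hZ.grInjective hΩs hZ₁ hZ₁inj 0)
  refine ⟨?_, fun l => ?_⟩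
  · simpa only [Diffiety.TerminatesAt, e] using hK
  · simp only [Diffiety.adaptedFiltration, e]
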